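/- Let $\mathbf{k}$ be a field. A braided Hopf algebra is a $\mathbf{k}$-vector space $R$ with an algebra structure $(m,1)$, a coalgebra structure $(\Delta,\varepsilon)$, a bijective solution $c=c_R:R\otimes R\to R\otimes R$ of the braid equation with which $m$, $1$, $\Delta$ and $\varepsilon$ commute, and an antipode (a convolution inverse of $\mathrm{id}_R$), such that $\varepsilon$ is an algebra map and $\Delta$ is an algebra map from $R$ to $R\otimes R$ with product $(m\otimes m)(\mathrm{id}\otimes c\otimes\mathrm{id})$. It is graded if $R=\bigoplus_{n\ge 0}R_n$ and all structure maps, including $c$, are homogeneous of degree $0$; if every $R_n$ is finite dimensional, its Hilbert series is $\eta(R,t)=\sum_{n\ge 0}\dim(R_n)\,t^n$. A map of braided graded Hopf algebras $\pi:R\to T$ is a homogeneous (degree $0$) algebra and coalgebra map with respect to which the braidings are natural: there are linear maps $c_{R,T}:R\otimes T\to T\otimes R$ and $c_{T,R}:T\otimes R\to R\otimes T$ with $$c_{R,T}(\mathrm{id}_R\otimes\pi)=(\pi\otimes\mathrm{id}_R)c_R,\qquad c_{T,R}(\pi\otimes\mathrm{id}_R)=(\mathrm{id}_R\otimes\pi)c_R,$$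 $$c_T(\pi\otimes\mathrm{id}_T)=(\mathrm{id}_T\otimes\pi)c_{R,T},\qquad c_T(\mathrm{id}_T\otimes\pi)=(\pi\otimes\mathrm{id}_T)c_{T,R}.$$ (This holds, for instance, whenever $R$ and $T$ are Hopf algebras and $\pi$ is a morphism in the braided category of Yetter-Drinfeld modules over a Hopf algebra with bijective antipode.) Let $\pi:R\to T$ be a surjective map of braided graded Hopf algebras which restricts to a bijection $R_0\to T_0$, and assume that $R_n$ and $T_n$ are finite dimensional for all $n$. Then $\eta(T,t)$ has nonzero constant term, and the quotient $\eta(R,t)/\eta(T,t)$, formed in $\mathbb{Q}[[t]]$, is a power series all of whose coefficients are nonnegative integers. -/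

import Mathlib

open scoped TensorProduct

section BraidedHopf

variable {k : Type*} [Field k]

/-- For `c : R ⊗ R → R ⊗ R`, the map `c ⊗ id` on `R ⊗ R ⊗ R`. -/
noncomputable def braidLeft {R : Type*} [AddCommGroup R] [Module k R] (c : R ⊗[k] R →ₗ[k] R ⊗[k] R) :
    R ⊗[k] (R ⊗[k] R) →ₗ[k] R ⊗[k] (R ⊗[k] R) :=
  (TensorProduct.assoc k R R R).toLinearMap ∘ₗ c.rTensor R ∘ₗ
    (TensorProduct.assoc k R R R).symm.toLinearMap

/-- For `c : R ⊗ R → R ⊗ R`, the map `id ⊗ c` on `R ⊗ R ⊗ R`. -/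
noncomputable def braidRight {R : Type*} [AddCommGroup R] [Module k R] (c : R ⊗[k] R →ₗ[k] R ⊗[k] R) :
    R ⊗[k] (R ⊗[k] R) →ₗ[k] R ⊗[k] (R ⊗[k] R) :=
  c.lTensor R

/-- For `c : R ⊗ R → R ⊗ R`, the map `id ⊗ c ⊗ id` on `(R ⊗ R) ⊗ (R ⊗ R)`. -/
noncomputable def braidMiddle {R : Type*} [AddCommGroup R] [Module k R] (c : R ⊗[k] R →ₗ[k] R ⊗[k] R) :
    (R ⊗[k] R) ⊗[k] (R ⊗[k] R) →ₗ[k] (R ⊗[k] R) ⊗[k] (R ⊗[k] R) :=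
  (TensorProduct.assoc k R R (R ⊗[k] R)).symm.toLinearMap ∘ₗ
    (braidLeft c).lTensor R ∘ₗ (TensorProduct.assoc k R R (R ⊗[k] R)).toLinearMap

variable (k) in
/-- The structure of a braided Hopf algebra (not necessarily inside a given braided category) on an
algebra `R` that is also a coalgebra: a bijective solution `c` of the braid equation with which
product, unit, coproduct and counit commute, such that the coproduct and the counit are algebra
maps (`R ⊗ R` carrying the product twisted by `c`), together with an antipode. -/
structure BraidedHopfStructure (R : Type*) [Ring R] [Algebra k R] [Coalgebra k R] where
  /-- the braiding `c` -/
  braiding : R ⊗[k] R ≃ₗ[k] R ⊗[k] R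
  /-- the antipode `S` -/
  antipode : R →ₗ[k] R
  braid_eq :
    braidLeft braiding.toLinearMap ∘ₗ braidRight braiding.toLinearMap ∘ₗ
        braidLeft braiding.toLinearMap =
      braidRight braiding.toLinearMap ∘ₗ braidLeft braiding.toLinearMap ∘ₗ
        braidRight braiding.toLinearMap
  /-- `c (m ⊗ id) = (id ⊗ m) (c ⊗ id) (id ⊗ c)` -/
  braiding_mul_left :
    braiding.toLinearMap ∘ₗ (LinearMap.mul' k R).rTensor R ∘ₗ
        (TensorProduct.assoc k R R R).symm.toLinearMap =
      (LinearMap.mul' k R).lTensor R ∘ₗ braidLeft braiding.toLinearMap ∘ₗ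
        braidRight braiding.toLinearMap
  /-- `c (id ⊗ m) = (m ⊗ id) (id ⊗ c) (c ⊗ id)` -/
  braiding_mul_right :
    braiding.toLinearMap ∘ₗ (LinearMap.mul' k R).lTensor R =
      (LinearMap.mul' k R).rTensor R ∘ₗ (TensorProduct.assoc k R R R).symm.toLinearMap ∘ₗ
        braidRight braiding.toLinearMap ∘ₗ braidLeft braiding.toLinearMap
  braiding_one_left : ∀ x : R, braiding (1 ⊗ₜ[k] x) = x ⊗ₜ[k] 1
  braiding_one_right : ∀ x : R, braiding (x ⊗ₜ[k] 1) = 1 ⊗ₜ[k] x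
  /-- `(id ⊗ Δ) c = (c ⊗ id) (id ⊗ c) (Δ ⊗ id)` -/
  braiding_comul_left :
    (Coalgebra.comul (R := k) (A := R)).lTensor R ∘ₗ braiding.toLinearMap =
      braidLeft braiding.toLinearMap ∘ₗ braidRight braiding.toLinearMap ∘ₗ
        (TensorProduct.assoc k R R R).toLinearMap ∘ₗ
          (Coalgebra.comul (R := k) (A := R)).rTensor R
  /-- `(Δ ⊗ id) c = (id ⊗ c) (c ⊗ id) (id ⊗ Δ)` -/
  braiding_comul_right :
    (TensorProduct.assoc k R R R).toLinearMap ∘ₗ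
        (Coalgebra.comul (R := k) (A := R)).rTensor R ∘ₗ braiding.toLinearMap =
      braidRight braiding.toLinearMap ∘ₗ braidLeft braiding.toLinearMap ∘ₗ
        (Coalgebra.comul (R := k) (A := R)).lTensor R
  braiding_counit_left : ∀ x y : R,
    (Coalgebra.counit (R := k) (A := R)).lTensor R (braiding (x ⊗ₜ[k] y)) =
      y ⊗ₜ[k] Coalgebra.counit (R := k) x
  braiding_counit_right : ∀ x y : R,
    (Coalgebra.counit (R := k) (A := R)).rTensor R (braiding (x ⊗ₜ[k] y)) =
      Coalgebra.counit (R := k) y ⊗ₜ[k] x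
  counit_one : Coalgebra.counit (R := k) (1 : R) = 1
  counit_mul : ∀ x y : R, Coalgebra.counit (R := k) (x * y) =
    Coalgebra.counit (R := k) x * Coalgebra.counit (R := k) y
  comul_one : Coalgebra.comul (R := k) (1 : R) = 1 ⊗ₜ[k] 1
  /-- `Δ m = (m ⊗ m) (id ⊗ c ⊗ id) (Δ ⊗ Δ)` -/
  comul_mul : ∀ x y : R, Coalgebra.comul (R := k) (x * y) =
    TensorProduct.map (LinearMap.mul' k R) (LinearMap.mul' k R)
      (braidMiddle braiding.toLinearMap
        (Coalgebra.comul (R := k) x ⊗ₜ[k] Coalgebra.comul (R := k) y))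
  antipode_left :
    LinearMap.mul' k R ∘ₗ antipode.rTensor R ∘ₗ Coalgebra.comul =
      Algebra.linearMap k R ∘ₗ Coalgebra.counit
  antipode_right :
    LinearMap.mul' k R ∘ₗ antipode.lTensor R ∘ₗ Coalgebra.comul =
      Algebra.linearMap k R ∘ₗ Coalgebra.counit

/-- The subspace `M ⊗ N` of `R ⊗ R`, for subspaces `M`, `N` of `R`. -/
noncomputable def tensorSubspace {R : Type*} [AddCommGroup R] [Module k R] (M N : Submodule k R) :
    Submodule k (R ⊗[k] R) :=
  LinearMap.range (TensorProduct.map M.subtype N.subtype)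

/-- Compatibility of a braided Hopf algebra with a grading `R = ⨁ₙ 𝒜 n` of the underlying algebra
(that `𝒜` is an algebra grading is the class `GradedAlgebra 𝒜`): the coproduct, the counit, the
antipode and the braiding are homogeneous of degree zero. -/
structure BraidedHopfStructure.IsGraded {R : Type*} [Ring R] [Algebra k R] [Coalgebra k R]
    (B : BraidedHopfStructure k R) (𝒜 : ℕ → Submodule k R) : Prop where
  comul_mem : ∀ n, ∀ x ∈ 𝒜 n, Coalgebra.comul (R := k) x ∈
    ⨆ (i : ℕ) (j : ℕ) (_ : i + j = n), tensorSubspace (𝒜 i) (𝒜 j)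
  counit_eq_zero : ∀ n, n ≠ 0 → ∀ x ∈ 𝒜 n, Coalgebra.counit (R := k) x = 0
  antipode_mem : ∀ n, ∀ x ∈ 𝒜 n, B.antipode x ∈ 𝒜 n
  braiding_mem : ∀ i j, ∀ x ∈ 𝒜 i, ∀ y ∈ 𝒜 j,
    B.braiding (x ⊗ₜ[k] y) ∈ tensorSubspace (𝒜 j) (𝒜 i)

/-- A map of algebras and coalgebras `π : R → T` is a map of braided Hopf algebras if the braidings
are natural with respect to `π`, as for a morphism in a braided category (for instance that of
Yetter-Drinfeld modules): there are braidings `c_{R,T}` and `c_{T,R}` making the squares with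
`id ⊗ π` and `π ⊗ id` commute. Composing two squares gives `c_T (π ⊗ π) = (π ⊗ π) c_R`; for a
surjective `π` the condition amounts to this equation together with `c_R (ker π ⊗ R) ⊆ R ⊗ ker π`
and `c_R (R ⊗ ker π) ⊆ ker π ⊗ R`. (Compatibility with the antipodes is automatic.) -/
def IsBraidedHopfMap {R T : Type*} [Ring R] [Algebra k R] [Coalgebra k R]
    [Ring T] [Algebra k T] [Coalgebra k T]
    (BR : BraidedHopfStructure k R) (BT : BraidedHopfStructure k T) (π : R →ₐc[k] T) : Prop :=
  ∃ (cRT : R ⊗[k] T →ₗ[k] T ⊗[k] R) (cTR : T ⊗[k] R →ₗ[k] R ⊗[k] T),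
    cRT ∘ₗ (π : R →ₗ[k] T).lTensor R = (π : R →ₗ[k] T).rTensor R ∘ₗ BR.braiding.toLinearMap ∧
    cTR ∘ₗ (π : R →ₗ[k] T).rTensor R = (π : R →ₗ[k] T).lTensor R ∘ₗ BR.braiding.toLinearMap ∧
    BT.braiding.toLinearMap ∘ₗ (π : R →ₗ[k] T).rTensor T = (π : R →ₗ[k] T).lTensor T ∘ₗ cRT ∧
    BT.braiding.toLinearMap ∘ₗ (π : R →ₗ[k] T).lTensor T = (π : R →ₗ[k] T).rTensor T ∘ₗ cTR

/-- The Hilbert series `∑ₙ dim (𝒜 n) tⁿ`, as a power series over `ℚ`. -/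
noncomputable def hilbertSeries {R : Type*} [AddCommGroup R] [Module k R]
    (𝒜 : ℕ → Submodule k R) : PowerSeries ℚ :=
  PowerSeries.mk fun n => (Module.finrank k (𝒜 n) : ℚ)

end BraidedHopf

section BraidedHopfQuotient
open Coalgebra TensorProduct

variable {k : Type*} [Field k]

section Graded

variable {R T : Type*} [AddCommGroup R] [Module k R] [AddCommGroup T] [Module k T]

/-- The degree `n` part of `R ⊗ T`, for families of subspaces of `R` and `T`. -/
noncomputable def tensorDegree (𝒜 : ℕ → Submodule k R) (ℬ : ℕ → Submodule k T) (n : ℕ) :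
    Submodule k (R ⊗[k] T) :=
  ⨆ (i : ℕ) (j : ℕ) (_ : i + j = n), LinearMap.range (map (𝒜 i).subtype (ℬ j).subtype)

lemma range_map_subtype_le_iff {V : Type*} [AddCommGroup V] [Module k V] (M : Submodule k R)
    (N : Submodule k T) (P : Submodule k V) (f : R ⊗[k] T →ₗ[k] V) :
    LinearMap.range (map M.subtype N.subtype) ≤ P.comap f ↔
      ∀ x ∈ M, ∀ y ∈ N, f (x ⊗ₜ y) ∈ P := by
  constructor
  · intro h x hx y hy
    exact h ⟨(⟨x, hx⟩ : M) ⊗ₜ (⟨y, hy⟩ : N), rfl⟩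
  · rintro h _ ⟨z, rfl⟩
    induction z with
    | zero => simp
    | tmul x y => exact h x x.2 y y.2
    | add a b ha hb => rw [map_add]; exact add_mem ha hb

lemma tensorDegree_le_comap {V : Type*} [AddCommGroup V] [Module k V] {𝒜 : ℕ → Submodule k R}
    {ℬ : ℕ → Submodule k T} {n : ℕ} {P : Submodule k V} {f : R ⊗[k] T →ₗ[k] V}
    (h : ∀ i j, i + j = n → ∀ x ∈ 𝒜 i, ∀ y ∈ ℬ j, f (x ⊗ₜ y) ∈ P) :
    tensorDegree 𝒜 ℬ n ≤ P.comap f :=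
  iSup_le fun i => iSup_le fun j => iSup_le fun hij =>
    (range_map_subtype_le_iff _ _ _ _).2 (h i j hij)

lemma eq_of_mem_tensorDegree {V : Type*} [AddCommGroup V] [Module k V] {𝒜 : ℕ → Submodule k R}
    {ℬ : ℕ → Submodule k T} {n : ℕ} {f g : R ⊗[k] T →ₗ[k] V}
    (h : ∀ i j, i + j = n → ∀ x ∈ 𝒜 i, ∀ y ∈ ℬ j, f (x ⊗ₜ y) = g (x ⊗ₜ y))
    {z : R ⊗[k] T} (hz : z ∈ tensorDegree 𝒜 ℬ n) : f z = g z := by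
  have := tensorDegree_le_comap (P := (⊥ : Submodule k V)) (f := f - g)
    (fun i j hij x hx y hy => by simp [h i j hij x hx y hy]) hz
  simpa [sub_eq_zero] using this

lemma eq_of_mem_range_map_subtype {V : Type*} [AddCommGroup V] [Module k V] {M : Submodule k R}
    {N : Submodule k T} {f g : R ⊗[k] T →ₗ[k] V}
    (h : ∀ x ∈ M, ∀ y ∈ N, f (x ⊗ₜ y) = g (x ⊗ₜ y))
    {z : R ⊗[k] T} (hz : z ∈ LinearMap.range (map M.subtype N.subtype)) : f z = g z := by
  have := (range_map_subtype_le_iff M N (⊥ : Submodule k V) (f - g)).2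
    (fun x hx y hy => by simp [h x hx y hy]) hz
  simpa [sub_eq_zero] using this

end Graded

section Proj

variable {R : Type*} [Ring R] [Algebra k R] (𝒜 : ℕ → Submodule k R) [GradedAlgebra 𝒜]

lemma proj_of_mem {i : ℕ} {x : R} (hx : x ∈ 𝒜 i) : GradedAlgebra.proj 𝒜 i x = x := by
  rw [GradedAlgebra.proj_apply, DirectSum.decompose_of_mem_same _ hx]

lemma proj_of_mem_ne {i j : ℕ} (hij : i ≠ j) {x : R} (hx : x ∈ 𝒜 i) :
    GradedAlgebra.proj 𝒜 j x = 0 := by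
  rw [GradedAlgebra.proj_apply, DirectSum.decompose_of_mem_ne _ hx hij]

lemma proj_mem (i : ℕ) (x : R) : GradedAlgebra.proj 𝒜 i x ∈ 𝒜 i := by
  rw [GradedAlgebra.proj_apply]; exact SetLike.coe_mem _

lemma hom_ext_of_grading {V : Type*} [AddCommGroup V] [Module k V] {f g : R →ₗ[k] V}
    (h : ∀ i, ∀ x ∈ 𝒜 i, f x = g x) : f = g := by
  ext x
  induction x using DirectSum.Decomposition.inductionOn 𝒜 with
  | zero => simp
  | homogeneous a => exact h _ _ a.2
  | add a b ha hb => simp [ha, hb]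

lemma proj_zero_mul_of_mem (x : R) {h : R} (hh : h ∈ 𝒜 0) :
    GradedAlgebra.proj 𝒜 0 (x * h) = GradedAlgebra.proj 𝒜 0 x * h := by
  have := map_mul (GradedRing.projZeroRingHom 𝒜) x h
  simp only [GradedRing.projZeroRingHom_apply] at this
  rw [GradedAlgebra.proj_apply, GradedAlgebra.proj_apply, this,
    DirectSum.decompose_of_mem_same 𝒜 hh]

end Proj

section BraidedProduct

variable {R : Type*} [Ring R] [Algebra k R]

/-- The product `(m ⊗ m) (id ⊗ c ⊗ id)` of `R ⊗ R`. -/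
noncomputable def braidedMul (c : R ⊗[k] R →ₗ[k] R ⊗[k] R) :
    (R ⊗[k] R) ⊗[k] (R ⊗[k] R) →ₗ[k] R ⊗[k] R :=
  map (LinearMap.mul' k R) (LinearMap.mul' k R) ∘ₗ braidMiddle c

lemma braidedMul_tmul (c : R ⊗[k] R →ₗ[k] R ⊗[k] R) (a b g h : R) :
    braidedMul c ((a ⊗ₜ b) ⊗ₜ (g ⊗ₜ h)) =
      map (LinearMap.mulLeft k a) (LinearMap.mulRight k h) (c (b ⊗ₜ g)) := by
  simp only [braidedMul, braidMiddle, braidLeft, LinearMap.comp_apply, LinearEquiv.coe_coe,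
    TensorProduct.assoc_tmul, LinearMap.lTensor_tmul, TensorProduct.assoc_symm_tmul, LinearMap.rTensor_tmul]
  induction c (b ⊗ₜ g) with
  | zero => simp
  | tmul x y => simp
  | add x y hx hy => simp only [add_tmul, tmul_add, map_add, hx, hy]

/-- The action of `R` on `R ⊗ T` by left multiplication on the first factor. -/
noncomputable def leftMulTensor (T : Type*) [AddCommGroup T] [Module k T] :
    R ⊗[k] (R ⊗[k] T) →ₗ[k] R ⊗[k] T :=
  (LinearMap.mul' k R).rTensor T ∘ₗ (TensorProduct.assoc k R R T).symm.toLinearMap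

lemma leftMulTensor_tmul {T : Type*} [AddCommGroup T] [Module k T] (a : R) (z : R ⊗[k] T) :
    leftMulTensor T (a ⊗ₜ z) = (LinearMap.mulLeft k a).rTensor T z := by
  induction z with
  | zero => simp
  | tmul x y => simp [leftMulTensor]
  | add x y hx hy => simp only [tmul_add, map_add, hx, hy]

lemma braidedMul_rTensor_mulLeft (c : R ⊗[k] R →ₗ[k] R ⊗[k] R) (a : R) (X Y : R ⊗[k] R) :
    braidedMul c ((LinearMap.mulLeft k a).rTensor R X ⊗ₜ Y) =
      (LinearMap.mulLeft k a).rTensor R (braidedMul c (X ⊗ₜ Y)) := by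
  induction X with
  | zero => simp
  | add x y hx hy => simp only [add_tmul, map_add, hx, hy]
  | tmul x y =>
    induction Y with
    | zero => simp
    | add x y hx hy => simp only [tmul_add, map_add, hx, hy]
    | tmul g h =>
      rw [LinearMap.rTensor_tmul, braidedMul_tmul, braidedMul_tmul, LinearMap.mulLeft_apply,
        LinearMap.mulLeft_mul, ← LinearMap.comp_apply (LinearMap.rTensor R _),
        LinearMap.rTensor_comp_map]

end BraidedProduct

section Hopf

variable {R : Type*} [Ring R] [Algebra k R] [Coalgebra k R] (B : BraidedHopfStructure k R)

lemma comul_mul_eq (x y : R) : comul (R := k) (x * y) =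
    braidedMul B.braiding.toLinearMap (comul x ⊗ₜ comul y) := B.comul_mul x y

variable {B} {𝒜 : ℕ → Submodule k R}

lemma comul_mem_tensorDegree (hB : B.IsGraded 𝒜) {n : ℕ} {x : R} (hx : x ∈ 𝒜 n) :
    comul (R := k) x ∈ tensorDegree 𝒜 𝒜 n := hB.comul_mem n x hx

lemma comul_mem_of_mem_zero (hB : B.IsGraded 𝒜) {x : R} (hx : x ∈ 𝒜 0) :
    comul (R := k) x ∈ LinearMap.range (map (𝒜 0).subtype (𝒜 0).subtype) := by
  have h := comul_mem_tensorDegree hB hx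
  refine (iSup_le fun i => iSup_le fun j => iSup_le fun hij => ?_ :
    tensorDegree 𝒜 𝒜 0 ≤ LinearMap.range (map (𝒜 0).subtype (𝒜 0).subtype)) h
  obtain ⟨rfl, rfl⟩ : i = 0 ∧ j = 0 := by omega
  exact le_rfl

variable [GradedAlgebra 𝒜]

lemma map_proj_comul (hB : B.IsGraded 𝒜) (x : R) :
    map (GradedAlgebra.proj 𝒜 0) (GradedAlgebra.proj 𝒜 0) (comul (R := k) x) =
      comul (GradedAlgebra.proj 𝒜 0 x) := by
  suffices h : map (GradedAlgebra.proj 𝒜 0) (GradedAlgebra.proj 𝒜 0) ∘ₗ comul (R := k) =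
      comul ∘ₗ GradedAlgebra.proj 𝒜 0 from LinearMap.congr_fun h x
  refine hom_ext_of_grading 𝒜 fun i x hx => ?_
  simp only [LinearMap.comp_apply]
  rcases eq_or_ne i 0 with rfl | hi
  · rw [proj_of_mem 𝒜 hx]
    refine eq_of_mem_range_map_subtype (g := LinearMap.id) (fun a ha b hb => ?_) (comul_mem_of_mem_zero hB hx)
    simp [proj_of_mem 𝒜 ha, proj_of_mem 𝒜 hb]
  · rw [proj_of_mem_ne 𝒜 hi hx, map_zero]
    refine eq_of_mem_tensorDegree (g := 0) (fun a b hab y hy z hz => ?_) (comul_mem_tensorDegree hB hx)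
    rcases eq_or_ne a 0 with rfl | ha
    · rw [TensorProduct.map_tmul, proj_of_mem_ne 𝒜 (i := b) (by omega) hz]; simp
    · rw [TensorProduct.map_tmul, proj_of_mem_ne 𝒜 ha hy]; simp

lemma counit_proj_zero (hB : B.IsGraded 𝒜) (x : R) :
    counit (R := k) (GradedAlgebra.proj 𝒜 0 x) = counit (R := k) x := by
  suffices h : counit (R := k) ∘ₗ GradedAlgebra.proj 𝒜 0 = counit (R := k) from
    LinearMap.congr_fun h x
  refine hom_ext_of_grading 𝒜 fun i x hx => ?_
  rcases eq_or_ne i 0 with rfl | hi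
  · simp [proj_of_mem 𝒜 hx]
  · simp [proj_of_mem_ne 𝒜 hi hx, hB.counit_eq_zero i hi x hx]

lemma lTensor_proj_braiding (hB : B.IsGraded 𝒜) (b : R) {h : R} (hh : h ∈ 𝒜 0) :
    (GradedAlgebra.proj 𝒜 0).lTensor R (B.braiding (b ⊗ₜ h)) =
      B.braiding (GradedAlgebra.proj 𝒜 0 b ⊗ₜ h) := by
  suffices H : (GradedAlgebra.proj 𝒜 0).lTensor R ∘ₗ B.braiding.toLinearMap ∘ₗ
      (TensorProduct.mk k R R).flip h = B.braiding.toLinearMap ∘ₗ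
      (TensorProduct.mk k R R).flip h ∘ₗ GradedAlgebra.proj 𝒜 0 from LinearMap.congr_fun H b
  refine hom_ext_of_grading 𝒜 fun i x hx => ?_
  have hmem := hB.braiding_mem i 0 x hx h hh
  simp only [LinearMap.comp_apply, LinearMap.flip_apply, mk_apply, LinearEquiv.coe_coe]
  rcases eq_or_ne i 0 with rfl | hi
  · rw [proj_of_mem 𝒜 hx]
    refine eq_of_mem_range_map_subtype (g := LinearMap.id) (fun a ha b hb => ?_) hmem
    simp [proj_of_mem 𝒜 hb]
  · rw [proj_of_mem_ne 𝒜 hi hx, zero_tmul, map_zero]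
    refine eq_of_mem_range_map_subtype (g := 0) (fun a ha b hb => ?_) hmem
    simp [proj_of_mem_ne 𝒜 hi hb]

lemma braiding_mem_of_right_mem_zero (hB : B.IsGraded 𝒜) (b : R) {h : R} (hh : h ∈ 𝒜 0) :
    B.braiding (b ⊗ₜ h) ∈ LinearMap.range ((𝒜 0).subtype.rTensor R) := by
  induction b using DirectSum.Decomposition.inductionOn 𝒜 with
  | zero => simp
  | add a b ha hb => rw [add_tmul, map_add]; exact add_mem ha hb
  | @homogeneous i a =>
    obtain ⟨z, hz⟩ := hB.braiding_mem i 0 a a.2 h hh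
    refine ⟨(𝒜 i).subtype.lTensor _ z, ?_⟩
    rw [← hz, ← LinearMap.comp_apply, LinearMap.rTensor_comp_lTensor]

lemma lTensor_proj_braidedMul (hB : B.IsGraded 𝒜) (X : R ⊗[k] R) {Y : R ⊗[k] R}
    (hY : Y ∈ LinearMap.range (map (𝒜 0).subtype (𝒜 0).subtype)) :
    (GradedAlgebra.proj 𝒜 0).lTensor R (braidedMul B.braiding.toLinearMap (X ⊗ₜ Y)) =
      braidedMul B.braiding.toLinearMap ((GradedAlgebra.proj 𝒜 0).lTensor R X ⊗ₜ Y) := by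
  induction X with
  | zero => simp
  | add x y hx hy => simp only [add_tmul, map_add, hx, hy]
  | tmul a b =>
    refine eq_of_mem_range_map_subtype
      (f := (GradedAlgebra.proj 𝒜 0).lTensor R ∘ₗ braidedMul B.braiding.toLinearMap ∘ₗ
        TensorProduct.mk k _ _ (a ⊗ₜ b))
      (g := braidedMul B.braiding.toLinearMap ∘ₗ
        TensorProduct.mk k _ _ ((GradedAlgebra.proj 𝒜 0).lTensor R (a ⊗ₜ b)))
      (fun g hg h hh => ?_) hY
    simp only [LinearMap.comp_apply, mk_apply, LinearMap.lTensor_tmul, braidedMul_tmul,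
      LinearEquiv.coe_coe]
    rw [← lTensor_proj_braiding hB b hg, ← LinearMap.comp_apply, ← LinearMap.comp_apply,
      LinearMap.lTensor_comp_map, LinearMap.map_comp_lTensor]
    congr 2
    ext x
    simp [proj_zero_mul_of_mem 𝒜 x hh]

end Hopf

section Coinvariants

variable {R : Type*} [Ring R] [Algebra k R] [Coalgebra k R] (B : BraidedHopfStructure k R)
  (𝒜 : ℕ → Submodule k R) [GradedAlgebra 𝒜]

/-- The map `x ↦ x₁ S(p x₂)`, where `p : R → R₀` is the projection. -/
noncomputable def coinvariantProj : R →ₗ[k] R :=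
  LinearMap.mul' k R ∘ₗ (B.antipode ∘ₗ GradedAlgebra.proj 𝒜 0).lTensor R ∘ₗ comul

variable {B 𝒜}

lemma antipode_conv_proj (hB : B.IsGraded 𝒜) (x : R) :
    LinearMap.mul' k R (map (B.antipode ∘ₗ GradedAlgebra.proj 𝒜 0) (GradedAlgebra.proj 𝒜 0)
      (comul (R := k) x)) = algebraMap k R (counit (R := k) x) := by
  have h := LinearMap.congr_fun B.antipode_left (GradedAlgebra.proj 𝒜 0 x)
  simp only [LinearMap.comp_apply, Algebra.linearMap_apply, counit_proj_zero hB,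
    ← map_proj_comul hB] at h
  rw [← h, ← LinearMap.comp_apply (LinearMap.rTensor R _), LinearMap.rTensor_comp_map]

/-- `P(x₁) p(x₂) = x`. -/
lemma coinvariantProj_conv_proj (hB : B.IsGraded 𝒜) (x : R) :
    LinearMap.mul' k R (map (coinvariantProj B 𝒜) (GradedAlgebra.proj 𝒜 0)
      (comul (R := k) x)) = x := by
  set p := GradedAlgebra.proj 𝒜 0
  have h1 : LinearMap.mul' k R ∘ₗ map (coinvariantProj B 𝒜) p =
      LinearMap.mul' k R ∘ₗ (LinearMap.mul' k R ∘ₗ map (B.antipode ∘ₗ p) p).lTensor R ∘ₗ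
        (TensorProduct.assoc k R R R).toLinearMap ∘ₗ (comul (R := k)).rTensor R := by
    ext a b
    simp only [coinvariantProj, LinearMap.comp_apply, AlgebraTensorModule.curry_apply,
      curry_apply, LinearMap.restrictScalars_self, TensorProduct.map_tmul,
      LinearMap.rTensor_tmul, LinearEquiv.coe_coe, LinearMap.mul'_apply]
    induction comul (R := k) a with
    | zero => simp
    | tmul x y => simp [p, mul_assoc]
    | add x y hx hy => simp only [add_tmul, map_add, add_mul, hx, hy]
  have h2 : LinearMap.mul' k R ∘ₗ map (B.antipode ∘ₗ p) p ∘ₗ comul (R := k) =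
      Algebra.linearMap k R ∘ₗ counit := LinearMap.ext (antipode_conv_proj hB)
  have h3 := LinearMap.congr_fun h1 (comul x)
  simp only [LinearMap.comp_apply, LinearEquiv.coe_coe, coassoc_apply] at h3
  rw [h3, ← LinearMap.comp_apply (LinearMap.lTensor R _), ← LinearMap.lTensor_comp,
    LinearMap.comp_assoc, h2, LinearMap.lTensor_comp, LinearMap.comp_apply, lTensor_counit_comul]
  simp

/-- `x₁ ⊗ f(x₂) = P(x₁) p(x₂) ⊗ f(x₃)`. -/
lemma lTensor_comul_eq (hB : B.IsGraded 𝒜) {V : Type*} [AddCommGroup V] [Module k V]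
    (f : R →ₗ[k] V) (x : R) :
    f.lTensor R (comul (R := k) x) =
      leftMulTensor V (map (coinvariantProj B 𝒜) (map (GradedAlgebra.proj 𝒜 0) f ∘ₗ comul)
        (comul (R := k) x)) := by
  set p := GradedAlgebra.proj 𝒜 0
  have hid : LinearMap.mul' k R ∘ₗ map (coinvariantProj B 𝒜) p ∘ₗ comul (R := k) =
      LinearMap.id := LinearMap.ext (coinvariantProj_conv_proj hB)
  have h1 : leftMulTensor V ∘ₗ map (coinvariantProj B 𝒜) (map p f) ∘ₗ
      (TensorProduct.assoc k R R R).toLinearMap =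
      map (LinearMap.mul' k R ∘ₗ map (coinvariantProj B 𝒜) p) f := by
    ext a b c
    simp [leftMulTensor]
  rw [← LinearMap.map_comp_lTensor, LinearMap.comp_apply, ← coassoc_apply]
  have h2 := LinearMap.congr_fun h1 (comul.rTensor R (comul (R := k) x))
  simp only [LinearMap.comp_apply, LinearEquiv.coe_coe] at h2
  rw [h2, ← LinearMap.comp_apply (map _ _), LinearMap.map_comp_rTensor, LinearMap.comp_assoc, hid]
  rfl

/-- `x₁ ⊗ p(x₂) = P(x₁) · Δ(p x₂)`. -/
lemma lTensor_proj_comul (hB : B.IsGraded 𝒜) (x : R) :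
    (GradedAlgebra.proj 𝒜 0).lTensor R (comul (R := k) x) =
      leftMulTensor R (map (coinvariantProj B 𝒜) (comul ∘ₗ GradedAlgebra.proj 𝒜 0)
        (comul (R := k) x)) := by
  have hΔ : (comul ∘ₗ GradedAlgebra.proj 𝒜 0 : R →ₗ[k] R ⊗[k] R) =
      map (GradedAlgebra.proj 𝒜 0) (GradedAlgebra.proj 𝒜 0) ∘ₗ comul :=
    LinearMap.ext fun y => (map_proj_comul hB y).symm
  rw [hΔ, ← lTensor_comul_eq hB]

lemma coinvariantProj_mul (hB : B.IsGraded 𝒜) (x : R) {h : R} (hh : h ∈ 𝒜 0) :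
    coinvariantProj B 𝒜 (x * h) = counit (R := k) h • coinvariantProj B 𝒜 x := by
  set μ : R ⊗[k] R →ₗ[k] R := LinearMap.mul' k R ∘ₗ B.antipode.lTensor R
  have hP (y : R) : coinvariantProj B 𝒜 y =
      μ ((GradedAlgebra.proj 𝒜 0).lTensor R (comul (R := k) y)) := by
    simp [coinvariantProj, μ, LinearMap.lTensor_comp]
  have hμ (a : R) (z : R ⊗[k] R) : μ ((LinearMap.mulLeft k a).rTensor R z) = a * μ z := by
    induction z with
    | zero => simp
    | tmul x y => simp [μ, mul_assoc]
    | add x y hx hy => simp only [map_add, mul_add, hx, hy]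
  have hμΔ (y : R) : μ (comul (R := k) y) = algebraMap k R (counit (R := k) y) :=
    LinearMap.congr_fun B.antipode_right y
  rw [hP, comul_mul_eq B, lTensor_proj_braidedMul hB _ (comul_mem_of_mem_zero hB hh),
    lTensor_proj_comul hB]
  have key : μ ∘ₗ braidedMul B.braiding.toLinearMap ∘ₗ
      (TensorProduct.mk k _ _).flip (comul (R := k) h) ∘ₗ leftMulTensor R ∘ₗ
      map (coinvariantProj B 𝒜) (comul ∘ₗ GradedAlgebra.proj 𝒜 0) =
      counit (R := k) h • (LinearMap.mul' k R ∘ₗ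
        map (coinvariantProj B 𝒜) (Algebra.linearMap k R ∘ₗ counit)) := by
    ext a b
    simp only [LinearMap.comp_apply, AlgebraTensorModule.curry_apply, curry_apply,
      LinearMap.restrictScalars_self, TensorProduct.map_tmul, leftMulTensor_tmul,
      LinearMap.flip_apply, mk_apply, braidedMul_rTensor_mulLeft, LinearMap.smul_apply,
      LinearMap.mul'_apply, Algebra.linearMap_apply]
    rw [← comul_mul_eq B, hμ, hμΔ, B.counit_mul, counit_proj_zero hB]
    simp [Algebra.algebraMap_eq_smul_one, smul_smul, mul_comm]
  have := LinearMap.congr_fun key (comul x)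
  simp only [LinearMap.comp_apply, LinearMap.flip_apply, mk_apply, LinearMap.smul_apply] at this
  rw [this]
  congr 1
  rw [← LinearMap.map_comp_lTensor, LinearMap.comp_apply, lTensor_counit_comul]
  simp

lemma rTensor_coinvariantProj_comul_mul (hB : B.IsGraded 𝒜) (x : R) {h : R} (hh : h ∈ 𝒜 0) :
    (coinvariantProj B 𝒜).rTensor R (comul (R := k) (x * h)) =
      map (coinvariantProj B 𝒜) (LinearMap.mulRight k h) (comul (R := k) x) := by
  set P := coinvariantProj B 𝒜
  have key (a b : R) : P.rTensor R (braidedMul B.braiding.toLinearMap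
      ((a ⊗ₜ b) ⊗ₜ comul (R := k) h)) = P a ⊗ₜ (b * h) := by
    have h1 := eq_of_mem_range_map_subtype
      (f := P.rTensor R ∘ₗ braidedMul B.braiding.toLinearMap ∘ₗ TensorProduct.mk k _ _ (a ⊗ₜ b))
      (g := TensorProduct.mk k _ _ (P a) ∘ₗ LinearMap.mulLeft k b ∘ₗ
        (TensorProduct.lid k R).toLinearMap ∘ₗ counit.rTensor R)
      (fun g hg g' _ => ?_) (comul_mem_of_mem_zero hB hh)
    · simpa using h1
    obtain ⟨w, hw⟩ := braiding_mem_of_right_mem_zero hB b hg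
    have h2 : P ∘ₗ LinearMap.mulLeft k a ∘ₗ (𝒜 0).subtype =
        LinearMap.toSpanSingleton k R (P a) ∘ₗ counit ∘ₗ (𝒜 0).subtype := by
      ext y
      simp [P, coinvariantProj_mul hB a y.2]
    have h3 := B.braiding_counit_right b g
    rw [← hw, ← LinearMap.comp_apply, ← LinearMap.rTensor_comp] at h3
    simp only [LinearMap.comp_apply, mk_apply, braidedMul_tmul, LinearEquiv.coe_coe, ← hw]
    rw [← LinearMap.comp_apply (map _ _), LinearMap.map_comp_rTensor,
      ← LinearMap.comp_apply (LinearMap.rTensor _ _), LinearMap.rTensor_comp_map, h2,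
      ← LinearMap.map_comp_rTensor, LinearMap.comp_apply, h3]
    simp [TensorProduct.smul_tmul']
  rw [comul_mul_eq B]
  induction comul (R := k) x with
  | zero => simp
  | tmul a b => simp [key]
  | add x y hx hy => simp only [add_tmul, map_add, hx, hy]

/-- `(P ⊗ id) Δ P = (P ⊗ P) Δ`. -/
lemma rTensor_coinvariantProj_comul_coinvariantProj (hB : B.IsGraded 𝒜) :
    (coinvariantProj B 𝒜).rTensor R ∘ₗ comul (R := k) ∘ₗ coinvariantProj B 𝒜 =
      map (coinvariantProj B 𝒜) (coinvariantProj B 𝒜) ∘ₗ comul := by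
  set P := coinvariantProj B 𝒜
  set F := B.antipode ∘ₗ GradedAlgebra.proj 𝒜 0
  have hP : P = LinearMap.mul' k R ∘ₗ F.lTensor R ∘ₗ comul := rfl
  have h1 : P.rTensor R ∘ₗ comul (R := k) ∘ₗ LinearMap.mul' k R ∘ₗ F.lTensor R =
      map P (LinearMap.mul' k R ∘ₗ F.lTensor R) ∘ₗ
        (TensorProduct.assoc k R R R).toLinearMap ∘ₗ comul.rTensor R := by
    ext a b
    have := rTensor_coinvariantProj_comul_mul hB a
      (hB.antipode_mem 0 _ (proj_mem 𝒜 0 b))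
    simp only [LinearMap.comp_apply, AlgebraTensorModule.curry_apply, curry_apply,
      LinearMap.restrictScalars_self, LinearMap.lTensor_tmul, LinearMap.mul'_apply,
      LinearMap.rTensor_tmul, LinearEquiv.coe_coe]
    refine this.trans ?_
    induction comul (R := k) a with
    | zero => simp
    | tmul x y => simp [P, F]
    | add x y hx hy => simp only [add_tmul, map_add, hx, hy]
  ext x
  have h2 := LinearMap.congr_fun h1 (comul x)
  simp only [LinearMap.comp_apply, LinearEquiv.coe_coe, coassoc_apply] at h2
  have h3 : map P P = map P (LinearMap.mul' k R ∘ₗ F.lTensor R) ∘ₗ comul.lTensor R := by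
    rw [LinearMap.map_comp_lTensor, LinearMap.comp_assoc, ← hP]
  rw [h3]
  exact h2

lemma coinvariantProj_mem (hB : B.IsGraded 𝒜) {n : ℕ} {x : R} (hx : x ∈ 𝒜 n) :
    coinvariantProj B 𝒜 x ∈ 𝒜 n := by
  refine tensorDegree_le_comap (P := 𝒜 n) (f := LinearMap.mul' k R ∘ₗ
    (B.antipode ∘ₗ GradedAlgebra.proj 𝒜 0).lTensor R) (fun i j hij a ha b hb => ?_)
    (comul_mem_tensorDegree hB hx)
  rcases eq_or_ne j 0 with rfl | hj
  · have := SetLike.mul_mem_graded ha (hB.antipode_mem 0 b hb)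
    rw [hij] at this
    simpa [proj_of_mem 𝒜 hb] using this
  · simp [proj_of_mem_ne 𝒜 hj hb]

lemma coinvariantProj_of_mem_zero (hB : B.IsGraded 𝒜) {x : R} (hx : x ∈ 𝒜 0) :
    coinvariantProj B 𝒜 x = algebraMap k R (counit (R := k) x) := by
  have h1 : coinvariantProj B 𝒜 1 = 1 := by
    have := LinearMap.congr_fun B.antipode_right 1
    simp only [LinearMap.comp_apply, B.comul_one, B.counit_one] at this
    simpa [coinvariantProj, B.comul_one, proj_of_mem 𝒜 SetLike.GradedOne.one_mem] using this
  simpa [h1, Algebra.algebraMap_eq_smul_one] using coinvariantProj_mul hB 1 hx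

end Coinvariants

section Coaction

variable {R T : Type*} [Ring R] [Algebra k R] [Coalgebra k R] [Ring T] [Algebra k T]
  [Coalgebra k T] {B : BraidedHopfStructure k R} {𝒜 : ℕ → Submodule k R} [GradedAlgebra 𝒜]
  {ℬ : ℕ → Submodule k T} {π : R →ₐc[k] T}

lemma map_map_comul (x : R) :
    map (π : R →ₗ[k] T) (π : R →ₗ[k] T) (comul x) = comul (R := k) (π x) :=
  CoalgHomClass.map_comp_comul_apply π x

lemma counit_map (x : R) : counit (R := k) (π x) = counit (R := k) x :=
  CoalgHomClass.counit_comp_apply π x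

variable (B 𝒜 π) in
/-- The map `x ↦ P(x₁) ⊗ π(x₂)`. -/
noncomputable def coinvariantCoaction : R →ₗ[k] R ⊗[k] T :=
  map (coinvariantProj B 𝒜) (π : R →ₗ[k] T) ∘ₗ comul

lemma coinvariantCoaction_mem (hB : B.IsGraded 𝒜) (hπ : ∀ n, ∀ x ∈ 𝒜 n, π x ∈ ℬ n) {n : ℕ}
    {x : R} (hx : x ∈ 𝒜 n) : coinvariantCoaction B 𝒜 π x ∈ tensorDegree 𝒜 ℬ n := by
  refine tensorDegree_le_comap (P := tensorDegree 𝒜 ℬ n)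
    (f := map (coinvariantProj B 𝒜) (π : R →ₗ[k] T))
    (fun i j hij a ha b hb => ?_) (comul_mem_tensorDegree hB hx)
  refine Submodule.mem_iSup_of_mem i (Submodule.mem_iSup_of_mem j
    (Submodule.mem_iSup_of_mem hij ?_))
  exact ⟨(⟨_, coinvariantProj_mem hB ha⟩ : 𝒜 i) ⊗ₜ (⟨_, hπ j b hb⟩ : ℬ j), rfl⟩

lemma lTensor_counit_coinvariantCoaction (x : R) :
    (counit (R := k)).lTensor R (coinvariantCoaction B 𝒜 π x) =
      coinvariantProj B 𝒜 x ⊗ₜ 1 := by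
  have : (counit (R := k)).lTensor R ∘ₗ map (coinvariantProj B 𝒜) (π : R →ₗ[k] T) =
      (coinvariantProj B 𝒜).rTensor k ∘ₗ counit.lTensor R := by
    ext a b
    simp
  have h := LinearMap.congr_fun this (comul x)
  simp only [LinearMap.comp_apply, lTensor_counit_comul] at h
  exact h

/-- `(Q ⊗ id) Q = (id ⊗ (g ⊗ id) Δ) Q`, if `g : T → T` lifts `P`. -/
lemma rTensor_coinvariantCoaction (hB : B.IsGraded 𝒜) {g : T →ₗ[k] T}
    (hg : ∀ x, g (π x) = π (coinvariantProj B 𝒜 x)) (x : R) :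
    TensorProduct.assoc k R T T ((coinvariantCoaction B 𝒜 π).rTensor T
      (coinvariantCoaction B 𝒜 π x)) =
      (g.rTensor T ∘ₗ comul).lTensor R (coinvariantCoaction B 𝒜 π x) := by
  set P := coinvariantProj B 𝒜
  set f : R →ₗ[k] T := (π : R →ₗ[k] T)
  have h1 : coinvariantCoaction B 𝒜 π ∘ₗ P = map P (f ∘ₗ P) ∘ₗ comul := by
    have := congrArg (fun F => f.lTensor R ∘ₗ F)
      (rTensor_coinvariantProj_comul_coinvariantProj hB)
    simp only [← LinearMap.comp_assoc, LinearMap.lTensor_comp_rTensor,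
      LinearMap.lTensor_comp_map] at this
    exact this
  have h2 : (g.rTensor T ∘ₗ comul) ∘ₗ f = map (f ∘ₗ P) f ∘ₗ comul := by
    ext y
    simp only [LinearMap.comp_apply]
    rw [show f y = π y from rfl, ← map_map_comul, ← LinearMap.comp_apply,
      LinearMap.rTensor_comp_map]
    congr 2
    ext z
    exact hg z
  have h3 : (TensorProduct.assoc k R T T).toLinearMap ∘ₗ map (map P (f ∘ₗ P)) f =
      map P (map (f ∘ₗ P) f) ∘ₗ (TensorProduct.assoc k R R R).toLinearMap := by
    ext a b c
    simp
  have h4 := LinearMap.congr_fun h3 (comul.rTensor R (comul (R := k) x))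
  simp only [LinearMap.comp_apply, LinearEquiv.coe_coe, coassoc_apply] at h4
  have hQ : coinvariantCoaction B 𝒜 π x = map P f (comul x) := rfl
  rw [hQ, ← LinearMap.comp_apply (LinearMap.rTensor _ _), ← LinearMap.comp_apply
    (LinearMap.lTensor _ _), LinearMap.rTensor_comp_map, LinearMap.lTensor_comp_map, h1, h2,
    ← LinearMap.map_comp_rTensor, show map P (map (f ∘ₗ P) f ∘ₗ comul) =
      map P (map (f ∘ₗ P) f) ∘ₗ comul.lTensor R by rw [LinearMap.map_comp_lTensor]]
  exact h4

section Section

variable {s : T →ₗ[k] R} (hs : ∀ x, s (π x) = GradedAlgebra.proj 𝒜 0 x)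
include hs

lemma eq_zero_of_coinvariantCoaction_eq_zero (hB : B.IsGraded 𝒜) {x : R}
    (hx : coinvariantCoaction B 𝒜 π x = 0) : x = 0 := by
  have h : map (coinvariantProj B 𝒜) (GradedAlgebra.proj 𝒜 0) =
      s.lTensor R ∘ₗ map (coinvariantProj B 𝒜) (π : R →ₗ[k] T) := by
    ext a b
    simp [hs]
  rw [← coinvariantProj_conv_proj hB x, h]
  have hx' : map (coinvariantProj B 𝒜) (π : R →ₗ[k] T) (comul x) = 0 := hx
  rw [LinearMap.comp_apply, hx', map_zero, map_zero]

lemma exists_lift_coinvariantProj :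
    ∃ g : T →ₗ[k] T, ∀ x, g (π x) = π (coinvariantProj B 𝒜 x) := by
  refine ⟨LinearMap.mul' k T ∘ₗ ((π : R →ₗ[k] T) ∘ₗ B.antipode ∘ₗ s).lTensor T ∘ₗ comul,
    fun x => ?_⟩
  simp only [coinvariantProj, LinearMap.comp_apply, ← map_map_comul]
  induction comul (R := k) x with
  | zero => simp
  | tmul a b => simp [hs]
  | add a b ha hb => simp only [map_add, ha, hb]

lemma lTensor_comul_of_coinvariant (hB : B.IsGraded 𝒜) {x : R}
    (hx : coinvariantCoaction B 𝒜 π x = x ⊗ₜ 1) (h1 : comul (R := k) (1 : T) = 1 ⊗ₜ 1) :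
    (π : R →ₗ[k] T).lTensor R (comul x) = x ⊗ₜ 1 := by
  have h : map (coinvariantProj B 𝒜)
      (map (GradedAlgebra.proj 𝒜 0) (π : R →ₗ[k] T) ∘ₗ comul) =
      (s.rTensor T ∘ₗ comul).lTensor R ∘ₗ map (coinvariantProj B 𝒜) (π : R →ₗ[k] T) := by
    rw [LinearMap.lTensor_comp_map]
    congr 1
    ext y
    simp only [LinearMap.comp_apply]
    rw [show (π : R →ₗ[k] T) y = π y from rfl, ← map_map_comul,
      ← LinearMap.comp_apply (LinearMap.rTensor _ _), LinearMap.rTensor_comp_map]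
    congr 2
    ext z
    exact (hs z).symm
  have hx' : map (coinvariantProj B 𝒜) (π : R →ₗ[k] T) (comul x) = x ⊗ₜ 1 := hx
  have hs1 : s 1 = 1 := by
    rw [← map_one π, hs, proj_of_mem 𝒜 SetLike.GradedOne.one_mem]
  rw [lTensor_comul_eq hB, h, LinearMap.comp_apply, hx', LinearMap.lTensor_tmul,
    leftMulTensor_tmul, LinearMap.comp_apply, h1]
  simp [hs1]

end Section

lemma lTensor_braidedMul_eq_zero {c : R ⊗[k] R →ₗ[k] R ⊗[k] R} {c' : T ⊗[k] R →ₗ[k] R ⊗[k] T}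
    (hc : c' ∘ₗ (π : R →ₗ[k] T).rTensor R = (π : R →ₗ[k] T).lTensor R ∘ₗ c) {X : R ⊗[k] R}
    (hX : (π : R →ₗ[k] T).lTensor R X = 0) (Y : R ⊗[k] R) :
    (π : R →ₗ[k] T).lTensor R (braidedMul c (X ⊗ₜ Y)) = 0 := by
  induction Y with
  | zero => simp
  | add x y hx hy => simp only [tmul_add, map_add, hx, hy, add_zero]
  | tmul g h =>
    have key : (π : R →ₗ[k] T).lTensor R ∘ₗ braidedMul c ∘ₗ
        (TensorProduct.mk k _ _).flip (g ⊗ₜ h) =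
        leftMulTensor T ∘ₗ ((LinearMap.mulRight k (π h)).lTensor R ∘ₗ c' ∘ₗ
          (TensorProduct.mk k _ _).flip g).lTensor R ∘ₗ (π : R →ₗ[k] T).lTensor R := by
      ext a b
      have hb : c' (π b ⊗ₜ g) = (π : R →ₗ[k] T).lTensor R (c (b ⊗ₜ g)) :=
        LinearMap.congr_fun hc (b ⊗ₜ g)
      simp only [LinearMap.comp_apply, AlgebraTensorModule.curry_apply, curry_apply,
        LinearMap.restrictScalars_self, LinearMap.flip_apply, mk_apply, braidedMul_tmul,
        LinearMap.lTensor_tmul, leftMulTensor_tmul]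
      rw [show (π : R →ₗ[k] T) b = π b from rfl, hb]
      induction c (b ⊗ₜ g) with
      | zero => simp
      | tmul x y => simp
      | add x y hx hy => simp only [map_add, hx, hy]
    have := LinearMap.congr_fun key X
    simpa only [LinearMap.comp_apply, LinearMap.flip_apply, mk_apply, hX, map_zero] using this

lemma lTensor_comul_mul_of_coinvariant {c' : T ⊗[k] R →ₗ[k] R ⊗[k] T}
    (hc : c' ∘ₗ (π : R →ₗ[k] T).rTensor R =
      (π : R →ₗ[k] T).lTensor R ∘ₗ B.braiding.toLinearMap) {x : R}
    (hx : (π : R →ₗ[k] T).lTensor R (comul x) = x ⊗ₜ 1) (y : R) :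
    (π : R →ₗ[k] T).lTensor R (comul (x * y)) =
      map (LinearMap.mulLeft k x) (π : R →ₗ[k] T) (comul y) := by
  have h0 := lTensor_braidedMul_eq_zero hc (X := comul x - x ⊗ₜ 1)
    (by rw [map_sub, hx]; simp) (comul y)
  rw [sub_tmul, map_sub, map_sub, sub_eq_zero] at h0
  rw [comul_mul_eq B, h0]
  induction comul (R := k) y with
  | zero => simp
  | tmul a b => simp [braidedMul_tmul, B.braiding_one_left]
  | add a b ha hb => simp only [tmul_add, map_add, ha, hb]

variable [GradedAlgebra ℬ]

lemma lTensor_proj_coinvariantCoaction_mul (hB : B.IsGraded 𝒜)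
    (hπ : ∀ n, ∀ x ∈ 𝒜 n, π x ∈ ℬ n) {c' : T ⊗[k] R →ₗ[k] R ⊗[k] T}
    (hc : c' ∘ₗ (π : R →ₗ[k] T).rTensor R =
      (π : R →ₗ[k] T).lTensor R ∘ₗ B.braiding.toLinearMap) {x : R}
    (hx : (π : R →ₗ[k] T).lTensor R (comul x) = x ⊗ₜ 1) {m : ℕ} {r : R} (hr : r ∈ 𝒜 m)
    {j : ℕ} (hj : m ≤ j) :
    (GradedAlgebra.proj ℬ j).lTensor R (coinvariantCoaction B 𝒜 π (x * r)) =
      coinvariantProj B 𝒜 x ⊗ₜ GradedAlgebra.proj ℬ j (π r) := by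
  have h1 : coinvariantCoaction B 𝒜 π (x * r) = (coinvariantProj B 𝒜).rTensor T
      (map (LinearMap.mulLeft k x) (π : R →ₗ[k] T) (comul r)) := by
    rw [← lTensor_comul_mul_of_coinvariant hc hx, ← LinearMap.comp_apply,
      LinearMap.rTensor_comp_lTensor]
    rfl
  have h2 := eq_of_mem_tensorDegree
    (f := (GradedAlgebra.proj ℬ j).lTensor R ∘ₗ (coinvariantProj B 𝒜).rTensor T ∘ₗ
      map (LinearMap.mulLeft k x) (π : R →ₗ[k] T))
    (g := TensorProduct.mk k _ _ (coinvariantProj B 𝒜 x) ∘ₗ GradedAlgebra.proj ℬ j ∘ₗ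
      (π : R →ₗ[k] T) ∘ₗ (TensorProduct.lid k R).toLinearMap ∘ₗ counit.rTensor R)
    (fun a b hab y hy z hz => ?_) (comul_mem_tensorDegree hB hr)
  · rw [h1]
    simpa using h2
  · rcases eq_or_ne a 0 with rfl | ha
    · simp [coinvariantProj_mul hB x hy, TensorProduct.smul_tmul']
    · have : GradedAlgebra.proj ℬ j (π z) = 0 := proj_of_mem_ne ℬ (by omega) (hπ b z hz)
      simp [this]

end Coaction

section LinearAlgebra

lemma finrank_eq_sum_finrank_map {V W : Type*} [AddCommGroup V] [Module k V] [AddCommGroup W]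
    [Module k W] [FiniteDimensional k V] (q : ℕ → V →ₗ[k] W) (F : ℕ → Submodule k V)
    (hF : ∀ m x, x ∈ F m ↔ ∀ j, m ≤ j → q j x = 0) (h0 : F 0 = ⊥) (m : ℕ) :
    Module.finrank k (F m) =
      ∑ j ∈ Finset.range m, Module.finrank k ((F (j + 1)).map (q j)) := by
  induction m with
  | zero => simp [h0]
  | succ m ih =>
    rw [Finset.sum_range_succ, ← ih, ← LinearMap.finrank_range_add_finrank_ker
      ((q m).domRestrict (F (m + 1))), LinearMap.range_domRestrict, add_comm]
    congr 1
    have hle : F m ≤ F (m + 1) := fun x hx =>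
      (hF _ _).2 fun j hj => (hF _ _).1 hx j (by omega)
    have hker : ((q m).domRestrict (F (m + 1))).ker = (F m).comap (F (m + 1)).subtype := by
      ext x
      simp only [LinearMap.mem_ker, LinearMap.domRestrict_apply, Submodule.mem_comap,
        Submodule.subtype_apply, hF m]
      refine ⟨fun h j hj => ?_, fun h => h m le_rfl⟩
      rcases hj.eq_or_lt with rfl | hj
      · exact h
      · exact (hF _ _).1 x.2 j hj
    rw [hker]
    exact (Submodule.comapSubtypeEquivOfLe hle).finrank_eq

lemma mem_range_map_ker {R T V : Type*} [AddCommGroup R] [Module k R] [AddCommGroup T]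
    [Module k T] [AddCommGroup V] [Module k V] {M : Submodule k R} {N : Submodule k T}
    (f : R →ₗ[k] V) {z : R ⊗[k] T} (hz : z ∈ LinearMap.range (map M.subtype N.subtype))
    (hfz : f.rTensor T z = 0) :
    z ∈ LinearMap.range (map (M.subtype ∘ₗ (f ∘ₗ M.subtype).ker.subtype) N.subtype) := by
  obtain ⟨w, rfl⟩ := hz
  have h1 : (f ∘ₗ M.subtype).rTensor N w = 0 := by
    apply Module.Flat.lTensor_preserves_injective_linearMap (M := V) N.subtype
      N.subtype_injective
    rw [map_zero, ← LinearMap.comp_apply, LinearMap.lTensor_comp_rTensor,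
      ← LinearMap.rTensor_comp_map]
    exact hfz
  obtain ⟨y, rfl⟩ := (Module.Flat.rTensor_exact N
    (LinearMap.exact_subtype_ker_map (f ∘ₗ M.subtype)) w).1 h1
  refine ⟨y, ?_⟩
  rw [← LinearMap.comp_apply, LinearMap.map_comp_rTensor]

end LinearAlgebra

section Graded

variable {R T : Type*} [AddCommGroup R] [Module k R] [Ring T] [Algebra k T]
  {𝒜 : ℕ → Submodule k R} {ℬ : ℕ → Submodule k T} [GradedAlgebra ℬ]

lemma sum_lTensor_proj {n : ℕ} {z : R ⊗[k] T} (hz : z ∈ tensorDegree 𝒜 ℬ n) :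
    ∑ j ∈ Finset.range (n + 1), (GradedAlgebra.proj ℬ j).lTensor R z = z := by
  rw [← LinearMap.sum_apply]
  refine eq_of_mem_tensorDegree (g := LinearMap.id) (fun i j hij x _ y hy => ?_) hz
  rw [LinearMap.sum_apply, Finset.sum_eq_single j]
  · simp [proj_of_mem ℬ hy]
  · intro l _ hl
    simp [proj_of_mem_ne ℬ hl.symm hy]
  · intro h
    simp at h
    omega

lemma lTensor_proj_mem {n m : ℕ} (hm : m ≤ n) {z : R ⊗[k] T} (hz : z ∈ tensorDegree 𝒜 ℬ n) :
    (GradedAlgebra.proj ℬ m).lTensor R z ∈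
      LinearMap.range (map (𝒜 (n - m)).subtype (ℬ m).subtype) := by
  refine tensorDegree_le_comap (f := (GradedAlgebra.proj ℬ m).lTensor R)
    (P := LinearMap.range (map (𝒜 (n - m)).subtype (ℬ m).subtype))
    (fun i j hij x hx y hy => ?_) hz
  rcases eq_or_ne j m with rfl | hj
  · obtain rfl : i = n - j := by omega
    exact ⟨(⟨x, hx⟩ : 𝒜 _) ⊗ₜ (⟨_, proj_mem ℬ j y⟩ : ℬ j), rfl⟩
  · simp [proj_of_mem_ne ℬ hj hy]

lemma lTensor_proj_eq_zero {n m : ℕ} (hm : n < m) {z : R ⊗[k] T}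
    (hz : z ∈ tensorDegree 𝒜 ℬ n) : (GradedAlgebra.proj ℬ m).lTensor R z = 0 := by
  refine eq_of_mem_tensorDegree (g := 0) (fun i j hij x hx y hy => ?_) hz
  simp [proj_of_mem_ne ℬ (show j ≠ m by omega) hy]

end Graded

section Coaction

variable {R T : Type*} [Ring R] [Algebra k R] [Coalgebra k R] [Ring T] [Algebra k T]
  [Coalgebra k T] {B : BraidedHopfStructure k R} {B' : BraidedHopfStructure k T}
  {𝒜 : ℕ → Submodule k R} [GradedAlgebra 𝒜]
  {ℬ : ℕ → Submodule k T} [GradedAlgebra ℬ] {π : R →ₐc[k] T}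

lemma proj_map (hπ : ∀ n, ∀ x ∈ 𝒜 n, π x ∈ ℬ n) (n : ℕ) (x : R) :
    GradedAlgebra.proj ℬ n (π x) = π (GradedAlgebra.proj 𝒜 n x) := by
  suffices h : GradedAlgebra.proj ℬ n ∘ₗ (π : R →ₗ[k] T) =
      (π : R →ₗ[k] T) ∘ₗ GradedAlgebra.proj 𝒜 n from LinearMap.congr_fun h x
  refine hom_ext_of_grading 𝒜 fun i x hx => ?_
  rcases eq_or_ne i n with rfl | hi
  · have := proj_of_mem ℬ (hπ i x hx)
    simp [proj_of_mem 𝒜 hx, this]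
  · have := proj_of_mem_ne ℬ hi (hπ i x hx)
    simp [proj_of_mem_ne 𝒜 hi hx, this]

lemma exists_mem_map_eq (hπ : ∀ n, ∀ x ∈ 𝒜 n, π x ∈ ℬ n) (hsurj : Function.Surjective π)
    {n : ℕ} {t : T} (ht : t ∈ ℬ n) : ∃ r ∈ 𝒜 n, π r = t := by
  obtain ⟨r, rfl⟩ := hsurj t
  exact ⟨_, proj_mem 𝒜 n r, by rw [← proj_map hπ, proj_of_mem ℬ ht]⟩

lemma exists_section_proj (hπ : ∀ n, ∀ x ∈ 𝒜 n, π x ∈ ℬ n) (hsurj : Function.Surjective π)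
    (hinj : Set.InjOn π (𝒜 0)) :
    ∃ s : T →ₗ[k] R, ∀ x, s (π x) = GradedAlgebra.proj 𝒜 0 x := by
  obtain ⟨s, hs⟩ := (π : R →ₗ[k] T).exists_rightInverse_of_surjective
    (LinearMap.range_eq_top.2 hsurj)
  refine ⟨GradedAlgebra.proj 𝒜 0 ∘ₗ s, fun x => ?_⟩
  refine hinj (proj_mem 𝒜 0 _) (proj_mem 𝒜 0 _) ?_
  rw [← proj_map hπ, ← proj_map hπ]
  congr 1
  exact LinearMap.congr_fun hs (π x)

lemma lift_coinvariantProj_of_mem_zero (hB : B.IsGraded 𝒜) (hπ : ∀ n, ∀ x ∈ 𝒜 n, π x ∈ ℬ n)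
    (hsurj : Function.Surjective π) {g : T →ₗ[k] T}
    (hg : ∀ x, g (π x) = π (coinvariantProj B 𝒜 x)) {t : T} (ht : t ∈ ℬ 0) :
    g t = algebraMap k T (counit (R := k) t) := by
  obtain ⟨r, hr, rfl⟩ := exists_mem_map_eq hπ hsurj ht
  rw [hg, coinvariantProj_of_mem_zero hB hr, counit_map]
  exact AlgHomClass.commutes π _

lemma map_lift_proj_comul (hB : B.IsGraded 𝒜) (hB' : B'.IsGraded ℬ)
    (hπ : ∀ n, ∀ x ∈ 𝒜 n, π x ∈ ℬ n) (hsurj : Function.Surjective π) {g : T →ₗ[k] T}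
    (hg : ∀ x, g (π x) = π (coinvariantProj B 𝒜 x)) {n m : ℕ} (hm : n ≤ m) {t : T}
    (ht : t ∈ ℬ n) :
    map g (GradedAlgebra.proj ℬ m) (comul (R := k) t) = 1 ⊗ₜ GradedAlgebra.proj ℬ m t := by
  have h := eq_of_mem_tensorDegree (f := map g (GradedAlgebra.proj ℬ m))
    (g := TensorProduct.mk k _ _ 1 ∘ₗ GradedAlgebra.proj ℬ m ∘ₗ
      (TensorProduct.lid k T).toLinearMap ∘ₗ counit.rTensor T)
    (fun i j hij x hx y hy => ?_) (comul_mem_tensorDegree hB' ht)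
  · simpa using h
  · rcases eq_or_ne i 0 with rfl | hi
    · simp [lift_coinvariantProj_of_mem_zero hB hπ hsurj hg hx, Algebra.algebraMap_eq_smul_one,
        TensorProduct.smul_tmul]
    · have : GradedAlgebra.proj ℬ m y = 0 := proj_of_mem_ne ℬ (by omega) hy
      simp [this]

variable (B 𝒜 π) in
/-- The elements `x` of degree `n` with `Q(x) = x ⊗ 1`. -/
noncomputable def coinvariants (n : ℕ) : Submodule k (𝒜 n) :=
  ((coinvariantCoaction B 𝒜 π - (TensorProduct.mk k R T).flip 1) ∘ₗ (𝒜 n).subtype).ker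

lemma mem_coinvariants {n : ℕ} {x : 𝒜 n} :
    x ∈ coinvariants B 𝒜 π n ↔ coinvariantCoaction B 𝒜 π x = (x : R) ⊗ₜ 1 := by
  simp [coinvariants, sub_eq_zero]

lemma lTensor_proj_coinvariantCoaction_mem (hB : B.IsGraded 𝒜) (hB' : B'.IsGraded ℬ)
    (hπ : ∀ n, ∀ x ∈ 𝒜 n, π x ∈ ℬ n) (hsurj : Function.Surjective π) {g : T →ₗ[k] T}
    (hg : ∀ x, g (π x) = π (coinvariantProj B 𝒜 x)) {n m : ℕ} (hm : m ≤ n) {x : R}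
    (hx : x ∈ 𝒜 n) (hxm : ∀ j, m + 1 ≤ j →
      (GradedAlgebra.proj ℬ j).lTensor R (coinvariantCoaction B 𝒜 π x) = 0) :
    (GradedAlgebra.proj ℬ m).lTensor R (coinvariantCoaction B 𝒜 π x) ∈
      LinearMap.range (map ((𝒜 (n - m)).subtype ∘ₗ (coinvariants B 𝒜 π (n - m)).subtype)
        (ℬ m).subtype) := by
  set Q := coinvariantCoaction B 𝒜 π
  have hQx : Q x ∈ tensorDegree 𝒜 ℬ n := coinvariantCoaction_mem hB hπ hx
  refine mem_range_map_ker _ (lTensor_proj_mem hm hQx) ?_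
  rw [LinearMap.rTensor_sub, LinearMap.sub_apply, sub_eq_zero]
  apply (TensorProduct.assoc k R T T).injective
  set D : T →ₗ[k] T ⊗[k] T := map g (GradedAlgebra.proj ℬ m) ∘ₗ comul
  have h1 : TensorProduct.assoc k R T T (Q.rTensor T
      ((GradedAlgebra.proj ℬ m).lTensor R (Q x))) = D.lTensor R (Q x) := by
    have e1 : (TensorProduct.assoc k R T T).toLinearMap ∘ₗ
        (GradedAlgebra.proj ℬ m).lTensor (R ⊗[k] T) =
        ((GradedAlgebra.proj ℬ m).lTensor T).lTensor R ∘ₗ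
          (TensorProduct.assoc k R T T).toLinearMap := by
      ext a b c
      simp
    have e2 : D = (GradedAlgebra.proj ℬ m).lTensor T ∘ₗ g.rTensor T ∘ₗ comul := by
      rw [← LinearMap.comp_assoc, LinearMap.lTensor_comp_rTensor]
    have e3 := LinearMap.congr_fun e1 (Q.rTensor T (Q x))
    simp only [LinearMap.comp_apply, LinearEquiv.coe_coe] at e3
    rw [← LinearMap.comp_apply (LinearMap.rTensor _ _), LinearMap.rTensor_comp_lTensor,
      ← LinearMap.lTensor_comp_rTensor, LinearMap.comp_apply, e3,
      rTensor_coinvariantCoaction hB hg, e2,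
      ← LinearMap.comp_apply (LinearMap.lTensor R (LinearMap.lTensor T _)),
      ← LinearMap.lTensor_comp]
  have h2 : TensorProduct.assoc k R T T (((TensorProduct.mk k R T).flip 1).rTensor T
      ((GradedAlgebra.proj ℬ m).lTensor R (Q x))) =
      (TensorProduct.mk k T T 1 ∘ₗ GradedAlgebra.proj ℬ m).lTensor R (Q x) := by
    induction Q x with
    | zero => simp
    | tmul a b => simp
    | add a b ha hb => simp only [map_add, ha, hb]
  rw [h1, h2, ← sum_lTensor_proj hQx, map_sum, map_sum]
  refine Finset.sum_congr rfl fun j _ => ?_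
  rcases lt_or_ge m j with hj | hj
  · rw [hxm j hj, map_zero, map_zero]
  · rw [← LinearMap.comp_apply (LinearMap.lTensor R _), ← LinearMap.comp_apply
      (LinearMap.lTensor R _), ← LinearMap.lTensor_comp, ← LinearMap.lTensor_comp]
    congr 2
    ext t
    exact map_lift_proj_comul hB hB' hπ hsurj hg hj (proj_mem ℬ j t)

theorem finrank_eq_sum_coinvariants (hB : B.IsGraded 𝒜) (hB' : B'.IsGraded ℬ)
    (hπ : ∀ n, ∀ x ∈ 𝒜 n, π x ∈ ℬ n) (hsurj : Function.Surjective π)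
    (hinj : Set.InjOn π (𝒜 0)) {c' : T ⊗[k] R →ₗ[k] R ⊗[k] T}
    (hc : c' ∘ₗ (π : R →ₗ[k] T).rTensor R =
      (π : R →ₗ[k] T).lTensor R ∘ₗ B.braiding.toLinearMap)
    (n : ℕ) [FiniteDimensional k (𝒜 n)] :
    Module.finrank k (𝒜 n) = ∑ m ∈ Finset.range (n + 1),
      Module.finrank k (coinvariants B 𝒜 π (n - m)) * Module.finrank k (ℬ m) := by
  obtain ⟨s, hs⟩ := exists_section_proj hπ hsurj hinj
  obtain ⟨g, hg⟩ := exists_lift_coinvariantProj (B := B) hs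
  set Q := coinvariantCoaction B 𝒜 π
  let q (j : ℕ) : 𝒜 n →ₗ[k] R ⊗[k] T := (GradedAlgebra.proj ℬ j).lTensor R ∘ₗ Q ∘ₗ (𝒜 n).subtype
  let F (m : ℕ) : Submodule k (𝒜 n) := ⨅ (j : ℕ) (_ : m ≤ j), (q j).ker
  have hF (m : ℕ) (x : 𝒜 n) : x ∈ F m ↔ ∀ j, m ≤ j → q j x = 0 := by
    simp [F, Submodule.mem_iInf]
  have h0 : F 0 = ⊥ := by
    refine (Submodule.eq_bot_iff _).2 fun x hx => ?_
    have hQx : _ = Q x := sum_lTensor_proj (coinvariantCoaction_mem hB hπ x.2)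
    rw [Finset.sum_eq_zero (f := fun j => (GradedAlgebra.proj ℬ j).lTensor R (Q x))
      fun j _ => (hF 0 x).1 hx j (Nat.zero_le j)] at hQx
    exact Subtype.ext (eq_zero_of_coinvariantCoaction_eq_zero hs hB hQx.symm)
  have htop : F (n + 1) = ⊤ := by
    refine (Submodule.eq_top_iff').2 fun x => (hF _ _).2 fun j hj => ?_
    exact lTensor_proj_eq_zero hj (coinvariantCoaction_mem hB hπ x.2)
  rw [← finrank_top k (𝒜 n), ← htop, finrank_eq_sum_finrank_map q F hF h0]
  refine Finset.sum_congr rfl fun m hm => ?_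
  have hm' : m ≤ n := by simpa [Nat.lt_succ_iff] using hm
  have himage : (F (m + 1)).map (q m) =
      LinearMap.range (map ((𝒜 (n - m)).subtype ∘ₗ (coinvariants B 𝒜 π (n - m)).subtype)
        (ℬ m).subtype) := by
    apply le_antisymm
    · rintro _ ⟨x, hx, rfl⟩
      exact lTensor_proj_coinvariantCoaction_mem hB hB' hπ hsurj hg hm' x.2
        ((hF _ _).1 hx)
    · rintro _ ⟨z, rfl⟩
      induction z with
      | zero => simp
      | add a b ha hb => rw [map_add]; exact add_mem ha hb
      | tmul x t =>
        obtain ⟨r, hr, hrt⟩ := exists_mem_map_eq hπ hsurj t.2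
        have hx := mem_coinvariants.1 x.2
        have hxP : coinvariantProj B 𝒜 (x : 𝒜 (n - m)) = ((x : 𝒜 (n - m)) : R) := by
          have := lTensor_counit_coinvariantCoaction (B := B) (𝒜 := 𝒜) (π := π)
            ((x : 𝒜 (n - m)) : R)
          rw [hx, LinearMap.lTensor_tmul, B'.counit_one] at this
          simpa using congrArg (TensorProduct.rid k R) this.symm
        have hxr : ((x : 𝒜 (n - m)) : R) * r ∈ 𝒜 n := by
          have := SetLike.mul_mem_graded (x : 𝒜 (n - m)).2 hr
          rwa [Nat.sub_add_cancel hm'] at this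
        have hq (j : ℕ) (hj : m ≤ j) : q j ⟨_, hxr⟩ =
            ((x : 𝒜 (n - m)) : R) ⊗ₜ GradedAlgebra.proj ℬ j (t : T) := by
          rw [← hrt]
          conv_rhs => rw [← hxP]
          exact lTensor_proj_coinvariantCoaction_mul hB hπ hc
            (lTensor_comul_of_coinvariant hs hB hx B'.comul_one) hr hj
        refine ⟨⟨_, hxr⟩, (hF _ _).2 fun j hj => ?_, ?_⟩
        · rw [hq j (by omega), proj_of_mem_ne ℬ (by omega) t.2, tmul_zero]
        · rw [hq m le_rfl, proj_of_mem ℬ t.2]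
          simp
  rw [himage, LinearMap.finrank_range_of_inj]
  · have := Module.Free.of_divisionRing k (coinvariants B 𝒜 π (n - m))
    exact Module.finrank_tensorProduct
  exact TensorProduct.map_injective_of_flat_flat _ _
    ((𝒜 (n - m)).subtype_injective.comp (coinvariants B 𝒜 π (n - m)).subtype_injective)
    (ℬ m).subtype_injective

end Coaction
end BraidedHopfQuotient

theorem mainTheorem5 {k : Type*} [Field k]
    {R T : Type*} [Ring R] [Algebra k R] [Coalgebra k R] [Ring T] [Algebra k T] [Coalgebra k T]
    (BR : BraidedHopfStructure k R) (BT : BraidedHopfStructure k T)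
    (𝒜 : ℕ → Submodule k R) [GradedAlgebra 𝒜] (hR : BR.IsGraded 𝒜)
    (ℬ : ℕ → Submodule k T) [GradedAlgebra ℬ] (hT : BT.IsGraded ℬ)
    (hRfin : ∀ n, FiniteDimensional k (𝒜 n)) (hTfin : ∀ n, FiniteDimensional k (ℬ n))
    (π : R →ₐc[k] T) (hπ : IsBraidedHopfMap BR BT π)
    (hπgr : ∀ n, ∀ x ∈ 𝒜 n, π x ∈ ℬ n)
    (hπsurj : Function.Surjective π)
    (hπ0 : Set.BijOn π (𝒜 0) (ℬ 0)) :
    PowerSeries.constantCoeff (hilbertSeries ℬ) ≠ 0 ∧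
      ∀ n, ∃ m : ℕ, PowerSeries.coeff n (hilbertSeries 𝒜 * (hilbertSeries ℬ)⁻¹) = (m : ℚ) := by
  have h0 : PowerSeries.constantCoeff (hilbertSeries ℬ) ≠ 0 := by
    have hone : (1 : T) ≠ 0 := fun h => by
      have := BT.counit_one
      rw [h, map_zero] at this
      exact zero_ne_one this
    have : Nontrivial (ℬ 0) :=
      ⟨⟨1, SetLike.GradedOne.one_mem⟩, 0, fun h => hone (congrArg Subtype.val h)⟩
    have := Module.finrank_pos (R := k) (M := ℬ 0)
    rw [← PowerSeries.coeff_zero_eq_constantCoeff_apply, hilbertSeries, PowerSeries.coeff_mk]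
    exact_mod_cast this.ne'
  refine ⟨h0, fun n => ⟨Module.finrank k (coinvariants BR 𝒜 π n), ?_⟩⟩
  obtain ⟨-, c', -, hc, -, -⟩ := hπ
  have h : hilbertSeries 𝒜 =
      PowerSeries.mk (fun n => (Module.finrank k (coinvariants BR 𝒜 π n) : ℚ)) *
        hilbertSeries ℬ := by
    ext n
    rw [PowerSeries.coeff_mul, ← Finset.Nat.sum_antidiagonal_swap,
      Finset.Nat.sum_antidiagonal_eq_sum_range_succ_mk]
    simp only [hilbertSeries, PowerSeries.coeff_mk, Prod.swap,
      finrank_eq_sum_coinvariants hR hT hπgr hπsurj hπ0.injOn hc n, Nat.cast_sum, Nat.cast_mul]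
  rw [h, mul_assoc, PowerSeries.mul_inv_cancel _ h0, mul_one, PowerSeries.coeff_mk]
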